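/- **Theorem.** Let $\lambda>0$ and let $X_1,X_2,\ldots$ be independent random variables with $X_i\sim\mathrm{Exp}(\lambda)$, i.e. with density $\lambda e^{-\lambda x}$ for $x>0$. Let $f:[0,\infty)\to\mathbb R$ be continuous with $f(0)=0$ and piecewise differentiable (every bounded interval contains only finitely many points of $(0,\infty)$ at which $f$ is not differentiable). For $k,l,m\in\mathbb N_0$ write $\mu_f(k,l,m)=\mathbb E[X^k f(X)^l f'(X)^m]$ with $X\sim\mathrm{Exp}(\lambda)$, and assume $\mathbb E[f(X)^2]<\infty$, $\mathbb E[f'(X)^2]<\infty$ and $\mu_f(0,1,0)\neq 0$. Put $$\overline{f(X)}=\frac1n\sum_{i=1}^n f(X_i),\qquad \overline{f'(X)}=\frac1n\sum_{i=1}^n f'(X_i),\qquad \hat\lambda_n=\frac{\overline{f'(X)}}{\overline{f(X)}} .$$ 1. (Asymptotic normality.) As $n\to\infty$, $\sqrt n\,(\hat\lambda_n-\lambda)\xrightarrow{d}\mathrm N(0,\sigma^2)$ with $\sigma^2=\mu_f(0,0,2)/\mu_f(0,1,0)^2>0$. That is, $\hat\lambda_n$ is asymptotically normally distributed with asymptotic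 variance $$\frac{\sigma^2}{n}=\frac1n\cdot\frac{\mu_f(0,0,2)}{\mu_f(0,1,0)^2}.$$ 2. (Asymptotic bias.) Let $T_n$ be the second-order Taylor polynomial of $g(u,v)=u/v$ at the point $\big(\mathbb E[f'(X)],\mathbb E[f(X)]\big)$, evaluated at $\big(\overline{f'(X)},\overline{f(X)}\big)$. Then $n\,(\hat\lambda_n-T_n)\to0$ in probability as $n\to\infty$, and for every $n\ge1$ the variable $T_n$ is integrable with $$\mathbb E[T_n]-\lambda=\frac{\lambda}{2n}\cdot\frac{\mu_f(0,2,0)}{\mu_f(0,1,0)^2}.$$ That is, the asymptotic bias of $\hat\lambda_n$ (the bias of its second-order Taylor approximation) equals the right-hand side. -/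

import Mathlib

open MeasureTheory ProbabilityTheory Filter Topology
open scoped NNReal

noncomputable section

/-- `f` is an admissible weight function on `[0, ∞)`: it vanishes at `0`, is continuous on `[0, ∞)`,
and is piecewise differentiable: every bounded interval contains only finitely many points of
`(0, ∞)` at which `f` is not differentiable.
(Values of `f` at negative arguments play no role.) -/
structure IsSteinWeight (f : ℝ → ℝ) : Prop where
  zero : f 0 = 0
  continuousOn : ContinuousOn f (Set.Ici 0)
  piecewise : ∀ R : ℝ, {x | 0 < x ∧ x ≤ R ∧ ¬ DifferentiableAt ℝ f x}.Finite

/-- `μ_f(k, l, m) = E[X ^ k * f(X) ^ l * f'(X) ^ m]` for `X ∼ Exp(lam)`. -/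
def steinMoment (lam : ℝ) (f : ℝ → ℝ) (k l m : ℕ) : ℝ :=
  ∫ x, x ^ k * f x ^ l * deriv f x ^ m ∂(expMeasure lam)

/-- The sample mean `(1/n) ∑ h(X_i)` of the first `n` observations. -/
def sampleMean {Ω : Type*} (h : ℝ → ℝ) (X : ℕ → Ω → ℝ) (n : ℕ) (ω : Ω) : ℝ :=
  (1 / (n : ℝ)) * ∑ i ∈ Finset.range n, h (X i ω)

/-- The Stein-MM estimator `mean(f'(X)) / mean(f(X))` of the rate of an exponential sample. -/
def steinMM {Ω : Type*} (f : ℝ → ℝ) (X : ℕ → Ω → ℝ) (n : ℕ) (ω : Ω) : ℝ :=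
  sampleMean (deriv f) X n ω / sampleMean f X n ω

/-- The estimators `T n` of `θ` are asymptotically normal with (nondegenerate) asymptotic variance
`s n`: `s n = v / n` for some `v > 0`, and `√n (T n - θ)` converges in law to `N(0, v)`. -/
def IsAsymptoticallyNormal {Ω : Type*} [MeasurableSpace Ω] (P : Measure Ω) [IsProbabilityMeasure P]
    (T : ℕ → Ω → ℝ) (θ : ℝ) (s : ℕ → ℝ) : Prop :=
  ∃ v : ℝ≥0, 0 < v ∧ (∀ n : ℕ, 1 ≤ n → s n = (v : ℝ) / n) ∧
    TendstoInDistribution (fun (n : ℕ) (ω : Ω) => √(n : ℝ) * (T n ω - θ)) atTop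
      (id : ℝ → ℝ) (fun _ => P) (gaussianReal 0 v)

/-- The second-order Taylor polynomial of `g` at `a`, evaluated at `z`. -/
def taylorTwo (g : ℝ × ℝ → ℝ) (a z : ℝ × ℝ) : ℝ :=
  g a + fderiv ℝ g a (z - a) + (1 / 2) * fderiv ℝ (fderiv ℝ g) a (z - a) (z - a)

/-- The estimators `T n = g (Z n)` of `θ` have asymptotic bias `b n` (in the sense of the delta
method at the point `a`): the second-order Taylor polynomial of `g` at `a` approximates `T n` up to
an error `o_P(1/n)`, it has a finite expectation, and this expectation differs from `θ` by `b n`. -/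
structure HasAsymptoticBias {Ω : Type*} [MeasurableSpace Ω] (P : Measure Ω)
    (T : ℕ → Ω → ℝ) (g : ℝ × ℝ → ℝ) (Z : ℕ → Ω → ℝ × ℝ) (a : ℝ × ℝ) (θ : ℝ) (b : ℕ → ℝ) :
    Prop where
  eq_comp : ∀ n ω, T n ω = g (Z n ω)
  remainder : TendstoInMeasure P
    (fun (n : ℕ) (ω : Ω) => (n : ℝ) * (T n ω - taylorTwo g a (Z n ω))) atTop (fun _ => 0)
  integrable : ∀ n : ℕ, 1 ≤ n → Integrable (fun ω => taylorTwo g a (Z n ω)) P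
  bias : ∀ n : ℕ, 1 ≤ n → (∫ ω, taylorTwo g a (Z n ω) ∂P) - θ = b n

end

/-! ### The exponential distribution -/

/-! Everything rests on Stein's identity `E[g'(X)] = λ E[g(X)]`, used for `g = f` and `g = f²`. Put
`h = f' - λ f`, `m = E[f(X)]`, and let `W`, `V` be the sample means of `h` and `f`. The identity for
`f` gives `E[h(X)] = 0`, and the estimation error is exactly `W / V`. The central limit theorem for
`W`, the law of large numbers for `V` and Slutsky's theorem give the limit variance `E[h²] / m²`;
the identity for `f²` turns `E[h²]` into `E[f'²]`.

For the bias, the Taylor polynomial is `λ + W/m - W(V - m)/m²`, with mean `λ - cov(h, f)/(n m²)`,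
and Stein for `f²` gives `cov(h, f) = -(λ/2) E[f²]`. Where `V ≠ 0`, `n` times the remainder is `n W
(V - m)` times `(V - m)/(m² V)`: the first factor is bounded in `L¹`, the second tends to `0` almost
surely. -/

lemma expMeasure_eq_restrict (lam : ℝ) :
    expMeasure lam = (volume.restrict (Set.Ioi 0)).withDensity
      fun x => ENNReal.ofReal (lam * Real.exp (-(lam * x))) := by
  have h : expMeasure lam = volume.withDensity (exponentialPDF lam) := rfl
  rw [h, ← withDensity_indicator measurableSet_Ioi]
  refine withDensity_congr_ae ?_
  filter_upwards [Measure.ae_ne volume (0 : ℝ)] with x hx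
  rw [exponentialPDF_eq]
  rcases lt_or_gt_of_ne hx with h | h
  · simp [h.not_ge, h.le]
  · simp [h, h.le]

lemma integrable_expMeasure_iff {lam : ℝ} (hlam : 0 < lam) {g : ℝ → ℝ} :
    Integrable g (expMeasure lam) ↔
      IntegrableOn (fun x => lam * Real.exp (-(lam * x)) * g x) (Set.Ioi 0) := by
  rw [expMeasure_eq_restrict, integrable_withDensity_iff_integrable_smul' (by fun_prop) (by simp),
    IntegrableOn]
  refine integrable_congr (Eventually.of_forall fun x => ?_)
  simp only [smul_eq_mul]
  rw [ENNReal.toReal_ofReal (by positivity)]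

lemma integral_expMeasure {lam : ℝ} (hlam : 0 < lam) (g : ℝ → ℝ) :
    ∫ x, g x ∂(expMeasure lam) = ∫ x in Set.Ioi 0, lam * Real.exp (-(lam * x)) * g x := by
  rw [expMeasure_eq_restrict, integral_withDensity_eq_integral_toReal_smul (by fun_prop) (by simp)]
  refine integral_congr_ae (Eventually.of_forall fun x => ?_)
  simp only [smul_eq_mul]
  rw [ENNReal.toReal_ofReal (by positivity)]

lemma expMeasure_absolutelyContinuous (lam : ℝ) :
    expMeasure lam ≪ volume.restrict (Set.Ioi 0) := by
  rw [expMeasure_eq_restrict]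
  exact withDensity_absolutelyContinuous _ _

/-- **Stein's identity** for the exponential distribution. -/
theorem integral_deriv_expMeasure {lam : ℝ} (hlam : 0 < lam) {g g' : ℝ → ℝ} {s : Set ℝ}
    (hs : s.Countable) (h0 : g 0 = 0) (hc : ContinuousOn g (Set.Ici 0))
    (hd : ∀ x ∈ Set.Ioi 0 \ s, HasDerivAt g (g' x) x)
    (hg : Integrable g (expMeasure lam)) (hg' : Integrable g' (expMeasure lam)) :
    ∫ x, g' x ∂(expMeasure lam) = lam * ∫ x, g x ∂(expMeasure lam) := by
  rw [integral_expMeasure hlam, integral_expMeasure hlam, ← integral_const_mul]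
  rw [integrable_expMeasure_iff hlam] at hg hg'
  -- Since `w' = -lam * w`, the integrand `w g' - lam w g` is the derivative of `w g`.
  set w : ℝ → ℝ := fun x => lam * Real.exp (-(lam * x))
  have hw (x : ℝ) : HasDerivAt w (-lam * w x) x := by
    have h1 : HasDerivAt (fun x : ℝ => -(lam * x)) (-lam) x := by
      simpa using ((hasDerivAt_id x).const_mul lam).fun_neg
    exact (h1.exp.const_mul lam).congr_deriv (by simp only [w]; ring)
  have hwc : Continuous w := by fun_prop
  have hI : IntegrableOn (fun x => w x * g' x - lam * (w x * g x)) (Set.Ioi 0) :=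
    hg'.sub (hg.const_mul lam)
  have hftc (R : ℝ) (hR : 0 ≤ R) :
      ∫ x in (0 : ℝ)..R, (w x * g' x - lam * (w x * g x)) = w R * g R := by
    rw [integral_eq_of_hasDerivAt_off_countable_of_le (fun x => w x * g x) _ hR hs]
    · simp [h0]
    · exact hwc.continuousOn.mul (hc.mono Set.Icc_subset_Ici_self)
    · intro x hx
      exact ((hw x).mul (hd x ⟨hx.1.1, hx.2⟩)).congr_deriv (by ring)
    · rw [intervalIntegrable_iff_integrableOn_Ioc_of_le hR]
      exact hI.mono_set Set.Ioc_subset_Ioi_self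
  have hlim := intervalIntegral_tendsto_integral_Ioi 0 hI tendsto_id
  have hlim' : Tendsto (fun R => w R * g R) atTop
      (𝓝 (∫ x in Set.Ioi 0, (w x * g' x - lam * (w x * g x)))) :=
    hlim.congr' ((eventually_ge_atTop 0).mono fun R hR => hftc R hR)
  -- No growth condition on `g` is needed: `w g` has a limit at infinity and is integrable on a
  -- half-line of infinite measure, so the limit is `0`.
  have hzero : ∫ x in Set.Ioi 0, (w x * g' x - lam * (w x * g x)) = 0 := by
    refine IntegrableAtFilter.eq_zero_of_tendsto (μ := volume) (l := atTop)
      (f := fun x => w x * g x) ⟨_, Ioi_mem_atTop 0, hg⟩ ?_ hlim'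
    intro s hs
    obtain ⟨b, hb⟩ := mem_atTop_sets.1 hs
    rw [← top_le_iff, ← Real.volume_Ici (a := b)]
    exact measure_mono hb
  rw [integral_sub hg' (hg.const_mul lam), sub_eq_zero] at hzero
  exact hzero

lemma hasDerivAt_deriv_of_mem_diff {f : ℝ → ℝ} {x : ℝ}
    (hx : x ∈ Set.Ioi 0 \ {x | 0 < x ∧ ¬ DifferentiableAt ℝ f x}) :
    HasDerivAt f (deriv f x) x :=
  (not_not.1 fun h => hx.2 ⟨hx.1, h⟩ : DifferentiableAt ℝ f x).hasDerivAt

/-! ### Stein's identity for `f` and `f ^ 2`. -/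

namespace IsSteinWeight

variable {f : ℝ → ℝ}

lemma countable_not_differentiableAt (hf : IsSteinWeight f) :
    {x | 0 < x ∧ ¬ DifferentiableAt ℝ f x}.Countable := by
  refine (Set.countable_iUnion fun n : ℕ => (hf.piecewise n).countable).mono fun x hx => ?_
  obtain ⟨n, hn⟩ := exists_nat_ge x
  exact Set.mem_iUnion.2 ⟨n, hx.1, hn, hx.2⟩

lemma aestronglyMeasurable (hf : IsSteinWeight f) (lam : ℝ) :
    AEStronglyMeasurable f (expMeasure lam) :=
  ((hf.continuousOn.mono Set.Ioi_subset_Ici_self).aestronglyMeasurable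
    measurableSet_Ioi).mono_ac (expMeasure_absolutelyContinuous lam)

lemma memLp_two (hf : IsSteinWeight f) {lam : ℝ}
    (hf2 : Integrable (fun x => f x ^ 2) (expMeasure lam)) : MemLp f 2 (expMeasure lam) :=
  (memLp_two_iff_integrable_sq (hf.aestronglyMeasurable lam)).2 hf2

lemma integral_deriv (hf : IsSteinWeight f) {lam : ℝ} (hlam : 0 < lam)
    (h1 : MemLp f 2 (expMeasure lam)) (h2 : MemLp (deriv f) 2 (expMeasure lam)) :
    ∫ x, deriv f x ∂(expMeasure lam) = lam * ∫ x, f x ∂(expMeasure lam) := by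
  have := isProbabilityMeasure_expMeasure hlam
  exact integral_deriv_expMeasure hlam hf.countable_not_differentiableAt hf.zero hf.continuousOn
    (fun x hx => hasDerivAt_deriv_of_mem_diff hx) (h1.integrable one_le_two) (h2.integrable one_le_two)

lemma integral_deriv_mul (hf : IsSteinWeight f) {lam : ℝ} (hlam : 0 < lam)
    (h1 : MemLp f 2 (expMeasure lam)) (h2 : MemLp (deriv f) 2 (expMeasure lam)) :
    2 * ∫ x, deriv f x * f x ∂(expMeasure lam) = lam * ∫ x, f x ^ 2 ∂(expMeasure lam) := by
  rw [← integral_const_mul]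
  refine integral_deriv_expMeasure (g := fun x => f x ^ 2) hlam hf.countable_not_differentiableAt
    (by simp [hf.zero]) (hf.continuousOn.pow 2) (fun x hx => ?_) h1.integrable_sq
    ((h2.integrable_mul h1).const_mul 2)
  exact ((hasDerivAt_deriv_of_mem_diff hx).pow 2).congr_deriv (by simp; ring)

end IsSteinWeight

/-! ### Sample means of an independent sample -/

section SampleMean

lemma ProbabilityTheory.HasLaw.memLp_comp {Ω : Type*} [MeasurableSpace Ω] {P : Measure Ω} {ν : Measure ℝ}
    {Y : Ω → ℝ} (hY : HasLaw Y ν P) {h : ℝ → ℝ} {p : ENNReal} (hh : MemLp h p ν) :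
    MemLp (fun ω => h (Y ω)) p P := by
  rw [← hY.map_eq] at hh
  exact (memLp_map_measure_iff hh.1 hY.aemeasurable).1 hh

variable {Ω : Type*} [MeasurableSpace Ω] {P : Measure Ω} {ν : Measure ℝ} {X : ℕ → Ω → ℝ} {h k : ℝ → ℝ}

lemma iIndepFun_comp_of_hasLaw (hindep : iIndepFun X P) (hlaw : ∀ i, HasLaw (X i) ν P)
    (hh : AEMeasurable h ν) : iIndepFun (fun i ω => h (X i ω)) P :=
  hindep.comp₀ (fun _ => h) (fun i => (hlaw i).aemeasurable)
    (fun i => by rw [(hlaw i).map_eq]; exact hh)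

lemma identDistrib_comp_of_hasLaw (hlaw : ∀ i, HasLaw (X i) ν P) (hh : AEMeasurable h ν) (i : ℕ) :
    IdentDistrib (fun ω => h (X i ω)) (fun ω => h (X 0 ω)) P P :=
  ((hlaw i).identDistrib (hlaw 0)).comp_of_aemeasurable (by rwa [(hlaw i).map_eq])

lemma memLp_sampleMean (hlaw : ∀ i, HasLaw (X i) ν P) {p : ENNReal} (hh : MemLp h p ν) (n : ℕ) :
    MemLp (sampleMean h X n) p P :=
  (memLp_finsetSum _ fun i _ => (hlaw i).memLp_comp hh).const_mul _

/-- The strong law of large numbers for sample means. -/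
lemma tendsto_sampleMean_ae (hindep : iIndepFun X P) (hlaw : ∀ i, HasLaw (X i) ν P)
    (hh : Integrable h ν) :
    ∀ᵐ ω ∂P, Tendsto (fun n => sampleMean h X n ω) atTop (𝓝 (∫ x, h x ∂ν)) := by
  have hm := hh.aemeasurable
  have := strong_law_ae_real (fun i ω => h (X i ω))
    (memLp_one_iff_integrable.1 ((hlaw 0).memLp_comp (memLp_one_iff_integrable.2 hh)))
    (fun i j hij => (iIndepFun_comp_of_hasLaw hindep hlaw hm).indepFun hij)
    (identDistrib_comp_of_hasLaw hlaw hm)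
  filter_upwards [this] with ω hω
  rw [← (hlaw 0).integral_comp hh.1]
  refine hω.congr fun n => ?_
  rw [sampleMean, one_div, inv_mul_eq_div]

lemma integral_sampleMean (hlaw : ∀ i, HasLaw (X i) ν P) (hh : Integrable h ν) {n : ℕ}
    (hn : 1 ≤ n) : ∫ ω, sampleMean h X n ω ∂P = ∫ x, h x ∂ν := by
  have hi (i : ℕ) : Integrable (fun ω => h (X i ω)) P :=
    memLp_one_iff_integrable.1 ((hlaw i).memLp_comp (memLp_one_iff_integrable.2 hh))
  have hc (i : ℕ) : ∫ ω, h (X i ω) ∂P = ∫ x, h x ∂ν := (hlaw i).integral_comp hh.1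
  have hn' : (n : ℝ) ≠ 0 := by positivity
  simp only [sampleMean]
  rw [integral_const_mul, integral_finsetSum _ fun i _ => hi i]
  simp only [hc, Finset.sum_const, Finset.card_range, nsmul_eq_mul]
  field_simp

variable [IsProbabilityMeasure P]

lemma covariance_sampleMean (hindep : iIndepFun X P) (hlaw : ∀ i, HasLaw (X i) ν P)
    (hh : MemLp h 2 ν) (hk : MemLp k 2 ν) (n : ℕ) :
    cov[sampleMean h X n, sampleMean k X n; P] = cov[h, k; ν] / n := by
  have hterm (i j : ℕ) : cov[fun ω => h (X i ω), fun ω => k (X j ω); P] =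
      if i = j then cov[h, k; ν] else 0 := by
    split_ifs with hij
    · subst hij
      exact (hlaw i).covariance_fun_comp hh.aemeasurable hk.aemeasurable
    · refine IndepFun.covariance_eq_zero ?_ ((hlaw i).memLp_comp hh) ((hlaw j).memLp_comp hk)
      exact (hindep.indepFun hij).comp₀ (hlaw i).aemeasurable (hlaw j).aemeasurable
        (by rw [(hlaw i).map_eq]; exact hh.aemeasurable)
        (by rw [(hlaw j).map_eq]; exact hk.aemeasurable)
  have hsum : cov[fun ω => ∑ i ∈ Finset.range n, h (X i ω),
      fun ω => ∑ i ∈ Finset.range n, k (X i ω); P] = n * cov[h, k; ν] := by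
    rw [covariance_fun_sum_fun_sum' (fun i _ => (hlaw i).memLp_comp hh)
      (fun i _ => (hlaw i).memLp_comp hk)]
    simp only [hterm, Finset.sum_ite_eq]
    rw [Finset.sum_congr rfl fun i hi => if_pos hi]
    simp
  have he (g : ℝ → ℝ) : sampleMean g X n =
      fun ω => (1 / (n : ℝ)) * ∑ i ∈ Finset.range n, g (X i ω) := rfl
  rw [he, he, covariance_const_mul_left, covariance_const_mul_right, hsum]
  -- For `n = 0` both sides vanish, because division by zero gives `0`.
  rcases eq_or_ne (n : ℝ) 0 with hn | hn
  · simp [hn]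
  · field_simp

/-- The expected product of two centred sample means. -/
lemma integral_sampleMean_mul (hindep : iIndepFun X P) (hlaw : ∀ i, HasLaw (X i) ν P)
    (hh : MemLp h 2 ν) (hk : MemLp k 2 ν) {n : ℕ} (hn : 1 ≤ n) :
    ∫ ω, (sampleMean h X n ω - ∫ x, h x ∂ν) * (sampleMean k X n ω - ∫ x, k x ∂ν) ∂P =
      cov[h, k; ν] / n := by
  have : IsProbabilityMeasure ν := (hlaw 0).isProbabilityMeasure_iff.1 inferInstance
  rw [← covariance_sampleMean hindep hlaw hh hk, covariance,
    integral_sampleMean hlaw (hh.integrable one_le_two) hn,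
    integral_sampleMean hlaw (hk.integrable one_le_two) hn]

/-- The central limit theorem for sample means of a centred function. -/
lemma tendstoInDistribution_sampleMean {Ω' : Type*} [MeasurableSpace Ω'] {P' : Measure Ω'}
    [IsProbabilityMeasure P'] {Y : Ω' → ℝ} (hindep : iIndepFun X P)
    (hlaw : ∀ i, HasLaw (X i) ν P) (hh : MemLp h 2 ν) (h0 : ∫ x, h x ∂ν = 0)
    (hY : HasLaw Y (gaussianReal 0 (∫ x, h x ^ 2 ∂ν).toNNReal) P') :
    TendstoInDistribution (fun (n : ℕ) ω => √(n : ℝ) * sampleMean h X n ω) atTop Y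
      (fun _ => P) P' := by
  have hm := hh.aemeasurable
  have hint : ∫ ω, h (X 0 ω) ∂P = 0 := by
    rw [← h0]; exact (hlaw 0).integral_comp hh.1
  have hvar : Var[fun ω => h (X 0 ω); P] = ∫ x, h x ^ 2 ∂ν := by
    rw [variance_of_integral_eq_zero ((hlaw 0).memLp_comp hh).aemeasurable hint]
    exact (hlaw 0).integral_comp (f := fun x => h x ^ 2) (hh.1.pow 2)
  have := tendstoInDistribution_inv_sqrt_mul_sum_sub (X := fun i ω => h (X i ω))
    (by rw [hvar]; exact hY) ((hlaw 0).memLp_comp hh) (iIndepFun_comp_of_hasLaw hindep hlaw hm)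
    (identDistrib_comp_of_hasLaw hlaw hm)
  refine this.congr (fun n => Eventually.of_forall fun ω => ?_) EventuallyEq.rfl
  simp only [sampleMean, hint, mul_zero, sub_zero]
  rw [← mul_assoc, mul_one_div, Real.sqrt_div_self', one_div]

end SampleMean

/-! ### Convergence in measure -/

/-- The product of a sequence bounded in `L¹` and a sequence that tends to `0` almost everywhere
tends to `0` in measure. -/
lemma tendstoInMeasure_mul_of_integral_norm_le {Ω : Type*} [MeasurableSpace Ω] {P : Measure Ω}
    [IsFiniteMeasure P] {A B : ℕ → Ω → ℝ} {C : ℝ} (hA : ∀ n, Integrable (A n) P)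
    (hAC : ∀ n, ∫ ω, ‖A n ω‖ ∂P ≤ C) (hB : ∀ n, AEStronglyMeasurable (B n) P)
    (hB0 : ∀ᵐ ω ∂P, Tendsto (fun n => B n ω) atTop (𝓝 0)) :
    TendstoInMeasure P (fun n ω => A n ω * B n ω) atTop (fun _ => 0) := by
  have hBm := tendstoInMeasure_of_tendsto_ae hB hB0
  rw [tendstoInMeasure_iff_measureReal_norm] at hBm ⊢
  have hC : 0 ≤ C := (integral_nonneg fun ω => norm_nonneg _).trans (hAC 0)
  intro ε hε
  rw [Metric.tendsto_atTop]
  intro δ hδ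
  -- Chosen so that `K * (δ / 2) = C + 1 > C`; Markov's inequality then bounds the probability of `K
  -- ≤ ‖A n‖` by less than `δ / 2`.
  set K : ℝ := 2 * (C + 1) / δ
  have hK : 0 < K := by positivity
  obtain ⟨N, hN⟩ := Metric.tendsto_atTop.1 (hBm (ε / K) (by positivity)) (δ / 2) (by positivity)
  refine ⟨N, fun n hn => ?_⟩
  have h1 : P.real {ω | K ≤ ‖A n ω‖} < δ / 2 := by
    have hmarkov := mul_meas_ge_le_integral_of_nonneg
      (Eventually.of_forall fun ω => norm_nonneg (A n ω)) (hA n).norm K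
    have : K * P.real {ω | K ≤ ‖A n ω‖} < K * (δ / 2) := by
      have : K * (δ / 2) = C + 1 := by simp only [K]; field_simp
      linarith [hAC n]
    exact lt_of_mul_lt_mul_left this hK.le
  have h2 := hN n hn
  rw [Real.dist_0_eq_abs, abs_of_nonneg measureReal_nonneg] at h2 ⊢
  have hsub : {ω | ε ≤ ‖A n ω * B n ω - 0‖} ⊆
      {ω | K ≤ ‖A n ω‖} ∪ {ω | ε / K ≤ ‖B n ω - 0‖} := by
    intro ω hω
    by_contra hcon
    simp only [Set.mem_union, Set.mem_ofPred_eq, not_or, not_le, sub_zero] at hcon hω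
    have : ‖A n ω * B n ω‖ < K * (ε / K) := by
      rw [norm_mul]
      exact mul_lt_mul'' hcon.1 hcon.2 (norm_nonneg _) (norm_nonneg _)
    rw [mul_div_cancel₀ _ hK.ne'] at this
    linarith
  calc P.real {ω | ε ≤ ‖A n ω * B n ω - 0‖}
      ≤ P.real ({ω | K ≤ ‖A n ω‖} ∪ {ω | ε / K ≤ ‖B n ω - 0‖}) := measureReal_mono hsub
    _ ≤ P.real {ω | K ≤ ‖A n ω‖} + P.real {ω | ε / K ≤ ‖B n ω - 0‖} := measureReal_union_le _ _
    _ < δ := by linarith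

lemma tendstoInMeasure_add_zero {Ω : Type*} [MeasurableSpace Ω] {P : Measure Ω}
    {A B : ℕ → Ω → ℝ} (hA : TendstoInMeasure P A atTop (fun _ => 0))
    (hB : TendstoInMeasure P B atTop (fun _ => 0)) :
    TendstoInMeasure P (fun n ω => A n ω + B n ω) atTop (fun _ => 0) := by
  rw [tendstoInMeasure_iff_norm] at hA hB ⊢
  intro ε hε
  have hsum := (hA (ε / 2) (by positivity)).add (hB (ε / 2) (by positivity))
  rw [add_zero] at hsum
  refine tendsto_of_tendsto_of_tendsto_of_le_of_le tendsto_const_nhds hsum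
    (fun _ => zero_le) fun n => (measure_mono fun ω hω => ?_).trans (measure_union_le _ _)
  by_contra hcon
  simp only [Set.mem_union, Set.mem_ofPred_eq, not_or, not_le, sub_zero] at hcon hω
  linarith [norm_add_le (A n ω) (B n ω)]

/-! ### The second-order Taylor polynomial of a quotient -/

lemma hasFDerivAt_fst_div_snd {z : ℝ × ℝ} (hz : z.2 ≠ 0) :
    HasFDerivAt (fun z : ℝ × ℝ => z.1 / z.2)
      (z.2⁻¹ • ContinuousLinearMap.fst ℝ ℝ ℝ -
        (z.1 * (z.2 ^ 2)⁻¹) • ContinuousLinearMap.snd ℝ ℝ ℝ) z := by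
  have h1 : HasFDerivAt (fun z : ℝ × ℝ => z.1) (ContinuousLinearMap.fst ℝ ℝ ℝ) z := hasFDerivAt_fst
  have h2 : HasFDerivAt (fun z : ℝ × ℝ => z.2⁻¹)
      (-(z.2 ^ 2)⁻¹ • ContinuousLinearMap.snd ℝ ℝ ℝ) z :=
    (hasDerivAt_inv hz).comp_hasFDerivAt z hasFDerivAt_snd
  simp only [div_eq_mul_inv]
  refine (h1.mul h2).congr_fderiv ?_
  ext <;> simp

lemma taylorTwo_fst_div_snd {a : ℝ × ℝ} (ha : a.2 ≠ 0) (z : ℝ × ℝ) :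
    taylorTwo (fun z => z.1 / z.2) a z =
      a.1 / a.2 + ((z.1 - a.1) / a.2 - a.1 * (z.2 - a.2) / a.2 ^ 2) +
        (a.1 * (z.2 - a.2) ^ 2 / a.2 ^ 3 - (z.1 - a.1) * (z.2 - a.2) / a.2 ^ 2) := by
  -- The formula for the first derivative needs `z.2 ≠ 0`; holding near `a` is enough to
  -- differentiate it again at `a`.
  have hev : fderiv ℝ (fun z : ℝ × ℝ => z.1 / z.2) =ᶠ[𝓝 a] fun z =>
      z.2⁻¹ • ContinuousLinearMap.fst ℝ ℝ ℝ -
        (z.1 * (z.2 ^ 2)⁻¹) • ContinuousLinearMap.snd ℝ ℝ ℝ := by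
    filter_upwards [continuousAt_snd.eventually_ne ha] with z hz
    exact (hasFDerivAt_fst_div_snd hz).fderiv
  have h1 : HasFDerivAt (fun z : ℝ × ℝ => z.1) (ContinuousLinearMap.fst ℝ ℝ ℝ) a := hasFDerivAt_fst
  have h2 : HasFDerivAt (fun z : ℝ × ℝ => z.2⁻¹)
      (-(a.2 ^ 2)⁻¹ • ContinuousLinearMap.snd ℝ ℝ ℝ) a :=
    (hasDerivAt_inv ha).comp_hasFDerivAt a hasFDerivAt_snd
  have h3 : HasFDerivAt (fun z : ℝ × ℝ => (z.2 ^ 2)⁻¹)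
      ((-(2 * a.2) / (a.2 ^ 2) ^ 2) • ContinuousLinearMap.snd ℝ ℝ ℝ) a := by
    have : HasDerivAt (fun y : ℝ => (y ^ 2)⁻¹) (-(2 * a.2) / (a.2 ^ 2) ^ 2) a.2 := by
      simpa using (hasDerivAt_pow 2 a.2).fun_inv (pow_ne_zero 2 ha)
    exact this.comp_hasFDerivAt a hasFDerivAt_snd
  have h4 := (h2.smul_const (ContinuousLinearMap.fst ℝ ℝ ℝ)).sub
    ((h1.mul h3).smul_const (ContinuousLinearMap.snd ℝ ℝ ℝ))
  have h5 := (h4.congr_of_eventuallyEq hev).fderiv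
  rw [taylorTwo, h5, hev.self_of_nhds]
  simp
  field_simp
  ring

/-! ### Asymptotic normality and asymptotic bias of the Stein-MM estimator -/

lemma sampleMean_sub_const_mul {Ω : Type*} (h k : ℝ → ℝ) (c : ℝ) (X : ℕ → Ω → ℝ) (n : ℕ) (ω : Ω) :
    sampleMean (fun x => h x - c * k x) X n ω = sampleMean h X n ω - c * sampleMean k X n ω := by
  simp only [sampleMean, Finset.sum_sub_distrib, ← Finset.mul_sum]
  ring

/-- This exact factorisation replaces the delta method: the numerator is centred, so the central
limit theorem applies to it alone. -/
lemma steinMM_sub {Ω : Type*} {lam : ℝ} {f : ℝ → ℝ} (X : ℕ → Ω → ℝ) {n : ℕ} {ω : Ω} (h : sampleMean f X n ω ≠ 0) :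
    steinMM f X n ω - lam =
      sampleMean (fun x => deriv f x - lam * f x) X n ω * (sampleMean f X n ω)⁻¹ := by
  rw [sampleMean_sub_const_mul, steinMM]
  field_simp

section SteinMM

variable {Ω : Type*} [MeasurableSpace Ω] {P : Measure Ω}
  {lam : ℝ} {X : ℕ → Ω → ℝ} {f : ℝ → ℝ}

lemma aemeasurable_steinMM (hlaw : ∀ i, HasLaw (X i) (expMeasure lam) P)
    (h1 : MemLp f 2 (expMeasure lam)) (h2 : MemLp (deriv f) 2 (expMeasure lam)) (n : ℕ) :
    AEMeasurable (steinMM f X n) P :=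
  (memLp_sampleMean hlaw h2 n).aemeasurable.div (memLp_sampleMean hlaw h1 n).aemeasurable

variable [IsProbabilityMeasure P]

lemma tendstoInDistribution_steinMM (hindep : iIndepFun X P)
    (hlaw : ∀ i, HasLaw (X i) (expMeasure lam) P)
    (h1 : MemLp f 2 (expMeasure lam)) (h2 : MemLp (deriv f) 2 (expMeasure lam))
    (hmean : ∫ x, (deriv f x - lam * f x) ∂(expMeasure lam) = 0)
    (hne : ∫ x, f x ∂(expMeasure lam) ≠ 0) {v : ℝ≥0}
    (hv : (v : ℝ) = (∫ x, (deriv f x - lam * f x) ^ 2 ∂(expMeasure lam)) /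
      (∫ x, f x ∂(expMeasure lam)) ^ 2) :
    TendstoInDistribution (fun (n : ℕ) ω => √(n : ℝ) * (steinMM f X n ω - lam)) atTop
      (id : ℝ → ℝ) (fun _ => P) (gaussianReal 0 v) := by
  have : IsProbabilityMeasure (expMeasure lam) :=
    (hlaw 0).isProbabilityMeasure_iff.1 inferInstance
  set m := ∫ x, f x ∂(expMeasure lam)
  set h : ℝ → ℝ := fun x => deriv f x - lam * f x
  have hh : MemLp h 2 (expMeasure lam) := h2.sub (h1.const_mul lam)
  have hlln := tendsto_sampleMean_ae hindep hlaw (h1.integrable one_le_two)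
  have hVm (n : ℕ) : AEMeasurable (sampleMean f X n) P :=
    (memLp_sampleMean hlaw h1 n).aemeasurable
  have hWm (n : ℕ) : AEMeasurable (sampleMean h X n) P :=
    (memLp_sampleMean hlaw hh n).aemeasurable
  have hTm (n : ℕ) : AEMeasurable (steinMM f X n) P := aemeasurable_steinMM hlaw h1 h2 n
  -- The limit of the numerator is realised as `z * m` with `z` of law `N(0, v)`, so that
  -- multiplying by `m⁻¹` in Slutsky's theorem leaves `id`.
  have hY : HasLaw (fun z : ℝ => z * m)
      (gaussianReal 0 (∫ x, h x ^ 2 ∂(expMeasure lam)).toNNReal) (gaussianReal 0 v) := by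
    convert gaussianReal_mul_const (HasLaw.id (μ := gaussianReal 0 v)) m using 2
    · simp
    · simp
    · refine NNReal.eq ?_
      rw [Real.coe_toNNReal _ (integral_nonneg fun x => sq_nonneg _)]
      simp only [NNReal.coe_mul, NNReal.coe_mk, hv]
      field_simp
      rfl
  have hclt := tendstoInDistribution_sampleMean hindep hlaw hh hmean hY
  have hinv : TendstoInMeasure P (fun n ω => (sampleMean f X n ω)⁻¹) atTop (fun _ => m⁻¹) :=
    tendstoInMeasure_of_tendsto_ae (fun n => (hVm n).inv.aestronglyMeasurable)
      (hlln.mono fun ω hω => hω.inv₀ hne)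
  have hslutsky := hclt.continuous_comp_prodMk_of_tendstoInMeasure_const
    (g := fun p : ℝ × ℝ => p.1 * p.2) (by fun_prop) hinv fun n => (hVm n).inv
  have hlim : (fun z : ℝ => z * m * m⁻¹) = id := by
    ext z
    simp [hne]
  simp only [hlim] at hslutsky
  -- The factorisation fails where the sample mean of `f` is zero, but almost surely that mean is
  -- nonzero for all large `n`.
  refine tendstoInDistribution_of_tendstoInMeasure_sub _ _ hslutsky ?_
    fun n => ((hTm n).sub_const lam).const_mul _
  refine tendstoInMeasure_of_tendsto_ae (fun n => ?_) ?_
  · exact ((((hTm n).sub_const lam).const_mul _).sub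
      (((hWm n).const_mul _).mul (hVm n).inv)).aestronglyMeasurable
  · filter_upwards [hlln] with ω hω
    refine tendsto_const_nhds.congr' ?_
    filter_upwards [hω.eventually_ne hne] with n hn
    simp only [Pi.sub_apply, Pi.zero_apply, steinMM_sub X hn]
    ring

/-- The second-order Taylor polynomial of the quotient at `(lam * m, m)`, in terms of the
deviations `u - lam * v` and `v - m`. -/
lemma taylorTwo_fst_div_snd_of_eq_mul {m : ℝ} (hm : m ≠ 0) (lam u v : ℝ) :
    taylorTwo (fun z => z.1 / z.2) (lam * m, m) (u, v) =
      lam + (u - lam * v) / m - (u - lam * v) * (v - m) / m ^ 2 := by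
  rw [taylorTwo_fst_div_snd hm]
  field_simp
  ring

lemma tendstoInMeasure_steinMM_sub_taylorTwo (hindep : iIndepFun X P)
    (hlaw : ∀ i, HasLaw (X i) (expMeasure lam) P)
    (h1 : MemLp f 2 (expMeasure lam)) (h2 : MemLp (deriv f) 2 (expMeasure lam))
    (hmean : ∫ x, (deriv f x - lam * f x) ∂(expMeasure lam) = 0) {m : ℝ}
    (hm : ∫ x, f x ∂(expMeasure lam) = m) (hne : m ≠ 0) :
    TendstoInMeasure P (fun (n : ℕ) ω => (n : ℝ) * (steinMM f X n ω -
      taylorTwo (fun z => z.1 / z.2) (lam * m, m)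
        (sampleMean (deriv f) X n ω, sampleMean f X n ω))) atTop (fun _ => 0) := by
  have : IsProbabilityMeasure (expMeasure lam) :=
    (hlaw 0).isProbabilityMeasure_iff.1 inferInstance
  set h : ℝ → ℝ := fun x => deriv f x - lam * f x
  have hh : MemLp h 2 (expMeasure lam) := h2.sub (h1.const_mul lam)
  have hlln := tendsto_sampleMean_ae hindep hlaw (h1.integrable one_le_two)
  rw [hm] at hlln
  have hV (n : ℕ) := memLp_sampleMean hlaw h1 n
  have hW (n : ℕ) := memLp_sampleMean hlaw hh n
  have hVc (n : ℕ) : MemLp (fun ω => sampleMean f X n ω - m) 2 P := (hV n).sub (memLp_const m)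
  have hTm (n : ℕ) : AEMeasurable (steinMM f X n) P := aemeasurable_steinMM hlaw h1 h2 n
  set A : ℕ → Ω → ℝ := fun n ω => n * (sampleMean h X n ω * (sampleMean f X n ω - m))
  set B : ℕ → Ω → ℝ := fun n ω => (sampleMean f X n ω - m) / m ^ 2 * (sampleMean f X n ω)⁻¹
  have hA (n : ℕ) : Integrable (A n) P := ((hW n).integrable_mul (hVc n)).const_mul _
  have hB (n : ℕ) : AEMeasurable (B n) P :=
    ((hVc n).aemeasurable.div_const _).mul (hV n).aemeasurable.inv
  have hB0 : ∀ᵐ ω ∂P, Tendsto (fun n => B n ω) atTop (𝓝 0) := by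
    filter_upwards [hlln] with ω hω
    simpa using ((hω.sub_const m).div_const (m ^ 2)).mul (hω.inv₀ hne)
  -- By `|xy| ≤ (x² + y²) / 2`; both squares have expectation of order `1 / n`, which cancels the
  -- factor `n`.
  have hAC (n : ℕ) : ∫ ω, ‖A n ω‖ ∂P ≤
      (cov[h, h; expMeasure lam] + cov[f, f; expMeasure lam]) / 2 := by
    rcases Nat.eq_zero_or_pos n with rfl | hn
    · rw [covariance_self hh.aemeasurable, covariance_self h1.aemeasurable]
      have h3 := variance_nonneg h (expMeasure lam)
      have h4 := variance_nonneg f (expMeasure lam)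
      simp only [A, Nat.cast_zero, zero_mul, norm_zero, integral_zero]
      positivity
    have hWW := integral_sampleMean_mul hindep hlaw hh hh hn
    have hVV := integral_sampleMean_mul hindep hlaw h1 h1 hn
    rw [hm] at hVV
    simp only [show ∫ x, h x ∂(expMeasure lam) = 0 from hmean, sub_zero] at hWW
    have hn' : (n : ℝ) ≠ 0 := by positivity
    have hi1 : Integrable (fun ω => sampleMean h X n ω * sampleMean h X n ω) P :=
      (hW n).integrable_mul (hW n)
    have hi2 : Integrable (fun ω => (sampleMean f X n ω - m) * (sampleMean f X n ω - m)) P :=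
      (hVc n).integrable_mul (hVc n)
    calc ∫ ω, ‖A n ω‖ ∂P
        ≤ ∫ ω, (n / 2 : ℝ) * (sampleMean h X n ω * sampleMean h X n ω +
            (sampleMean f X n ω - m) * (sampleMean f X n ω - m)) ∂P := by
          refine integral_mono (hA n).norm ((hi1.add hi2).const_mul _) fun ω => ?_
          simp only [A, norm_mul, Real.norm_eq_abs, Nat.abs_cast]
          have hx := abs_mul_abs_self (sampleMean h X n ω)
          have hy := abs_mul_abs_self (sampleMean f X n ω - m)
          rw [← hx, ← hy, div_mul_eq_mul_div, mul_div_assoc]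
          refine mul_le_mul_of_nonneg_left ?_ n.cast_nonneg
          nlinarith [sq_nonneg (|sampleMean h X n ω| - |sampleMean f X n ω - m|)]
      _ = (cov[h, h; expMeasure lam] + cov[f, f; expMeasure lam]) / 2 := by
          rw [integral_const_mul, integral_add hi1 hi2, hWW, hVV]
          field_simp
  have hAB := tendstoInMeasure_mul_of_integral_norm_le hA hAC
    (fun n => (hB n).aestronglyMeasurable) hB0
  set R : ℕ → Ω → ℝ := fun n ω => (n : ℝ) * (steinMM f X n ω -
      taylorTwo (fun z => z.1 / z.2) (lam * m, m)
        (sampleMean (deriv f) X n ω, sampleMean f X n ω))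
  have hR (n : ℕ) : R n = fun ω => (n : ℝ) * (steinMM f X n ω - (lam + sampleMean h X n ω / m -
      sampleMean h X n ω * (sampleMean f X n ω - m) / m ^ 2)) := by
    ext ω
    simp only [R, h, taylorTwo_fst_div_snd_of_eq_mul hne, sampleMean_sub_const_mul]
  have hRm (n : ℕ) : AEMeasurable (R n) P := by
    rw [hR]
    exact ((hTm n).sub ((((hW n).aemeasurable.div_const m).const_add lam).sub
      (((hW n).aemeasurable.mul (hVc n).aemeasurable).div_const _))).const_mul _
  -- `R n = A n * B n` wherever the sample mean of `f` is nonzero, hence almost surely for all large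
  -- `n`.
  have hdiff : TendstoInMeasure P (fun n ω => R n ω - A n ω * B n ω) atTop (fun _ => 0) := by
    refine tendstoInMeasure_of_tendsto_ae
      (fun n => ((hRm n).sub ((hA n).aemeasurable.mul (hB n))).aestronglyMeasurable) ?_
    filter_upwards [hlln] with ω hω
    refine tendsto_const_nhds.congr' ?_
    filter_upwards [hω.eventually_ne hne] with n hn
    have := steinMM_sub (lam := lam) X hn
    simp only [hR, A, B]
    rw [sub_eq_iff_eq_add.1 this]
    simp only [h]
    field_simp
    ring
  simpa using tendstoInMeasure_add_zero hdiff hAB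

/-- The linear term has mean zero, and the quadratic one is a product of two centred sample means.
-/
lemma integral_taylorTwo_sampleMean (hindep : iIndepFun X P)
    (hlaw : ∀ i, HasLaw (X i) (expMeasure lam) P)
    (h1 : MemLp f 2 (expMeasure lam)) (h2 : MemLp (deriv f) 2 (expMeasure lam))
    (hmean : ∫ x, (deriv f x - lam * f x) ∂(expMeasure lam) = 0) {m : ℝ}
    (hm : ∫ x, f x ∂(expMeasure lam) = m) (hne : m ≠ 0) {n : ℕ} (hn : 1 ≤ n) :
    Integrable (fun ω => taylorTwo (fun z => z.1 / z.2) (lam * m, m)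
        (sampleMean (deriv f) X n ω, sampleMean f X n ω)) P ∧
      ∫ ω, taylorTwo (fun z => z.1 / z.2) (lam * m, m)
        (sampleMean (deriv f) X n ω, sampleMean f X n ω) ∂P =
      lam - cov[fun x => deriv f x - lam * f x, f; expMeasure lam] / n / m ^ 2 := by
  have : IsProbabilityMeasure (expMeasure lam) :=
    (hlaw 0).isProbabilityMeasure_iff.1 inferInstance
  set h : ℝ → ℝ := fun x => deriv f x - lam * f x
  have hh : MemLp h 2 (expMeasure lam) := h2.sub (h1.const_mul lam)
  have hW := memLp_sampleMean hlaw hh n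
  have hVc : MemLp (fun ω => sampleMean f X n ω - m) 2 P :=
    (memLp_sampleMean hlaw h1 n).sub (memLp_const m)
  have hT : (fun ω => taylorTwo (fun z => z.1 / z.2) (lam * m, m)
      (sampleMean (deriv f) X n ω, sampleMean f X n ω)) =
      fun ω => lam + sampleMean h X n ω / m -
        sampleMean h X n ω * (sampleMean f X n ω - m) / m ^ 2 := by
    ext ω
    simp only [h, taylorTwo_fst_div_snd_of_eq_mul hne, sampleMean_sub_const_mul]
  have hi1 : Integrable (fun ω => sampleMean h X n ω / m) P :=
    (hW.integrable one_le_two).div_const m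
  have hi2 : Integrable (fun ω => lam + sampleMean h X n ω / m) P := (integrable_const lam).add hi1
  have hi3 : Integrable (fun ω => sampleMean h X n ω * (sampleMean f X n ω - m) / m ^ 2) P :=
    (hW.integrable_mul hVc).div_const _
  have hcov := integral_sampleMean_mul hindep hlaw hh h1 hn
  simp only [show ∫ x, h x ∂(expMeasure lam) = 0 from hmean, hm, sub_zero] at hcov
  rw [hT]
  refine ⟨hi2.sub hi3, ?_⟩
  rw [integral_sub hi2 hi3, integral_add (integrable_const _) hi1, integral_div, integral_div, hcov,
    integral_sampleMean hlaw (hh.integrable one_le_two) hn, hmean]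
  simp

end SteinMM

/-! ### Moments of the centred function `f' - lam * f`. -/

namespace IsSteinWeight

variable {f : ℝ → ℝ} {lam : ℝ}

lemma integral_deriv_sub (hf : IsSteinWeight f) (hlam : 0 < lam)
    (h1 : MemLp f 2 (expMeasure lam)) (h2 : MemLp (deriv f) 2 (expMeasure lam)) :
    ∫ x, (deriv f x - lam * f x) ∂(expMeasure lam) = 0 := by
  have := isProbabilityMeasure_expMeasure hlam
  rw [integral_sub (h2.integrable one_le_two) ((h1.integrable one_le_two).const_mul lam),
    integral_const_mul, hf.integral_deriv hlam h1 h2, sub_self]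

lemma covariance_deriv_sub (hf : IsSteinWeight f) (hlam : 0 < lam)
    (h1 : MemLp f 2 (expMeasure lam)) (h2 : MemLp (deriv f) 2 (expMeasure lam)) :
    cov[fun x => deriv f x - lam * f x, f; expMeasure lam] =
      -(lam / 2) * ∫ x, f x ^ 2 ∂(expMeasure lam) := by
  have := isProbabilityMeasure_expMeasure hlam
  have h3 := hf.integral_deriv_mul hlam h1 h2
  have hi : Integrable (fun x => deriv f x * f x) (expMeasure lam) := h2.integrable_mul h1
  have hh : MemLp (fun x => deriv f x - lam * f x) 2 (expMeasure lam) := h2.sub (h1.const_mul lam)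
  rw [covariance_eq_sub hh h1, hf.integral_deriv_sub hlam h1 h2]
  simp only [Pi.mul_apply, sub_mul, mul_assoc, ← sq, zero_mul, sub_zero]
  rw [integral_sub hi (h1.integrable_sq.const_mul lam), integral_const_mul]
  linarith

/-- Expanding the square, the terms `-2 lam E[f f']` and `lam ^ 2 E[f ^ 2]` cancel by Stein's
identity for `f ^ 2`. -/
lemma integral_deriv_sub_sq (hf : IsSteinWeight f) (hlam : 0 < lam)
    (h1 : MemLp f 2 (expMeasure lam)) (h2 : MemLp (deriv f) 2 (expMeasure lam)) :
    ∫ x, (deriv f x - lam * f x) ^ 2 ∂(expMeasure lam) =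
      ∫ x, deriv f x ^ 2 ∂(expMeasure lam) := by
  have h3 := hf.integral_deriv_mul hlam h1 h2
  have hi : Integrable (fun x => deriv f x * f x) (expMeasure lam) := h2.integrable_mul h1
  have he (x : ℝ) : (deriv f x - lam * f x) ^ 2 =
      deriv f x ^ 2 - (2 * lam * (deriv f x * f x) - lam ^ 2 * f x ^ 2) := by ring
  simp only [he]
  have hi1 := hi.const_mul (2 * lam)
  have hi2 := h1.integrable_sq.const_mul (lam ^ 2)
  have hi3 : Integrable (fun x => 2 * lam * (deriv f x * f x) - lam ^ 2 * f x ^ 2)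
    (expMeasure lam) := hi1.sub hi2
  rw [integral_sub h2.integrable_sq hi3, integral_sub hi1 hi2, integral_const_mul,
    integral_const_mul]
  linear_combination -lam * h3

/-- Otherwise `f' = 0` almost everywhere, and Stein's identity would force `E[f(X)] = 0`. -/
lemma integral_deriv_sq_pos (hf : IsSteinWeight f) (hlam : 0 < lam)
    (h1 : MemLp f 2 (expMeasure lam)) (h2 : MemLp (deriv f) 2 (expMeasure lam))
    (hne : ∫ x, f x ∂(expMeasure lam) ≠ 0) : 0 < ∫ x, deriv f x ^ 2 ∂(expMeasure lam) := by
  refine lt_of_le_of_ne (integral_nonneg fun x => sq_nonneg _) fun h0 => hne ?_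
  have hae := (integral_eq_zero_iff_of_nonneg (fun x => sq_nonneg (deriv f x))
    h2.integrable_sq).1 h0.symm
  have hz : ∫ x, deriv f x ∂(expMeasure lam) = 0 :=
    integral_eq_zero_of_ae (hae.mono fun x hx => by simpa using hx)
  rw [hf.integral_deriv hlam h1 h2] at hz
  exact (mul_eq_zero.1 hz).resolve_left hlam.ne'

end IsSteinWeight

theorem mainTheorem4 {Ω : Type*} [MeasurableSpace Ω] (P : Measure Ω) [IsProbabilityMeasure P]
    (lam : ℝ) (hlam : 0 < lam)
    (X : ℕ → Ω → ℝ) (hindep : iIndepFun X P) (hlaw : ∀ i, HasLaw (X i) (expMeasure lam) P)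
    (f : ℝ → ℝ) (hf : IsSteinWeight f)
    (hf2 : Integrable (fun x => f x ^ 2) (expMeasure lam))
    (hf'2 : Integrable (fun x => deriv f x ^ 2) (expMeasure lam))
    (hne : steinMoment lam f 0 1 0 ≠ 0) :
    IsAsymptoticallyNormal P (steinMM f X) lam
      (fun n => (1 / (n : ℝ)) * (steinMoment lam f 0 0 2 / steinMoment lam f 0 1 0 ^ 2)) ∧
    HasAsymptoticBias P (steinMM f X) (fun z => z.1 / z.2)
      (fun n ω => (sampleMean (deriv f) X n ω, sampleMean f X n ω))
      (∫ x, deriv f x ∂(expMeasure lam), ∫ x, f x ∂(expMeasure lam)) lam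
      (fun n => (lam / (2 * (n : ℝ))) * (steinMoment lam f 0 2 0 / steinMoment lam f 0 1 0 ^ 2)) := by
  have : IsProbabilityMeasure (expMeasure lam) := isProbabilityMeasure_expMeasure hlam
  have h1 : MemLp f 2 (expMeasure lam) := hf.memLp_two hf2
  have h2 : MemLp (deriv f) 2 (expMeasure lam) :=
    (memLp_two_iff_integrable_sq (measurable_deriv f).aestronglyMeasurable).2 hf'2
  simp only [steinMoment, pow_zero, one_mul, mul_one, pow_one] at hne ⊢
  have hmean := hf.integral_deriv_sub hlam h1 h2
  have hpos := hf.integral_deriv_sq_pos hlam h1 h2 hne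
  obtain ⟨v, hv⟩ : ∃ v : ℝ≥0, (v : ℝ) =
      (∫ x, deriv f x ^ 2 ∂(expMeasure lam)) / (∫ x, f x ∂(expMeasure lam)) ^ 2 :=
    ⟨Real.toNNReal _, Real.coe_toNNReal _ (by positivity)⟩
  refine ⟨⟨v, ?_, fun n _ => ?_, ?_⟩, ?_⟩
  · rw [← NNReal.coe_pos, hv]
    positivity
  · exact (one_div_mul_eq_div _ _).trans (by rw [hv])
  · refine tendstoInDistribution_steinMM hindep hlaw h1 h2 hmean hne ?_
    rw [hf.integral_deriv_sub_sq hlam h1 h2, hv]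
  -- Stein's identity puts the base point in the form `(lam * m, m)`.
  · rw [hf.integral_deriv hlam h1 h2]
    refine ⟨fun n ω => rfl, tendstoInMeasure_steinMM_sub_taylorTwo hindep hlaw h1 h2 hmean rfl hne,
      fun n hn => (integral_taylorTwo_sampleMean hindep hlaw h1 h2 hmean rfl hne hn).1,
      fun n hn => ?_⟩
    have hn' : (n : ℝ) ≠ 0 := by positivity
    rw [(integral_taylorTwo_sampleMean hindep hlaw h1 h2 hmean rfl hne hn).2,
      hf.covariance_deriv_sub hlam h1 h2]
    field_simp
    ring
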